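/- Let $s\in(0,1)$, $m>0$, and let $A:\mathbb{R}^3\to\mathbb{R}^3$ be a continuous field with locally bounded (weak) gradient, i.e. a locally Lipschitz field. Write $2^*_s=\frac{6}{3-2s}$ and $C_s=\frac{s\,2^{(2s-1)/2}}{\pi^{3/2}\Gamma(1-s)}$, and let $\mathcal K_\nu(\zeta)=\frac12\left(\frac{\zeta}{2}\right)^{\nu}\int_0^{\infty}e^{-\frac{\zeta^2}{4t}-t}\,t^{-1-\nu}\,dt$ $(\zeta>0)$ be the modified Bessel function of the third kind. For measurable $u:\mathbb{R}^3\to\mathbb{C}$ put $$\|u\|_{A,s}^2=\frac{C_s}{2}\,m^{\frac{3+2s}{2}}\int_{\mathbb{R}^3\times\mathbb{R}^3}\frac{\left|e^{-i(x-y)\cdot A\left(\frac{x+y}{2}\right)}u(x)-u(y)\right|^2}{|x-y|^{\frac{3+2s}{2}}}\,\mathcal K_{\frac{3+2s}{2}}(m|x-y|)\,dx\,dy+m^{2s}\int_{\mathbb{R}^3}|u(x)|^2\,dx ,$$ let $\mathcal H$ be the space of all (classes of) measurable $u$ with $\|u\|_{A,s}<\infty$, and let $H^s_A(\mathbb{R}^3,\mathbb{C})$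 be the closure of $C^\infty_c(\mathbb{R}^3,\mathbb{C})$ in $(\mathcal H,\|\cdot\|_{A,s})$. Then: 1. For every $q\in[2,2^*_s]$, $H^s_A(\mathbb{R}^3,\mathbb{C})$ embeds continuously into $L^q(\mathbb{R}^3,\mathbb{C})$: there is $C\ge 0$ such that every $u\in H^s_A(\mathbb{R}^3,\mathbb{C})$ lies in $L^q(\mathbb{R}^3,\mathbb{C})$ and satisfies $\|u\|_{L^q(\mathbb{R}^3,\mathbb{C})}\le C\|u\|_{A,s}$. 2. For every $q\in[1,2^*_s)$, $H^s_A(\mathbb{R}^3,\mathbb{C})$ embeds compactly into $L^q_{\mathrm{loc}}(\mathbb{R}^3,\mathbb{C})$: the inclusion $H^s_A(\mathbb{R}^3,\mathbb{C})\subset L^q_{\mathrm{loc}}(\mathbb{R}^3,\mathbb{C})$ holds; for every compact $K\subset\mathbb{R}^3$ there is $C_K\ge 0$ with $\|u\|_{L^q(K)}\le C_K\|u\|_{A,s}$ for all $u\in H^s_A(\mathbb{R}^3,\mathbb{C})$; and every sequence bounded in $H^s_A(\mathbb{R}^3,\mathbb{C})$ has a subsequence converging, in $L^q(K)$ for every compact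 $K\subset\mathbb{R}^3$, to some $v\in L^q_{\mathrm{loc}}(\mathbb{R}^3,\mathbb{C})$. -/

import Mathlib

open MeasureTheory Filter Topology
open scoped NNReal ENNReal ContDiff

noncomputable section

namespace MagneticSobolev

/-- Euclidean three-space. -/
abbrev E3 : Type := EuclideanSpace ℝ (Fin 3)

/-- The modified Bessel function (of the third kind, or Macdonald function) `K_ν(ζ)`, through its
integral representation; used only at `ζ > 0`, where the integrand is integrable on `(0, ∞)`. -/
def besselK (ν ζ : ℝ) : ℝ :=
  1 / 2 * (ζ / 2) ^ ν *
    ∫ t in Set.Ioi (0 : ℝ), Real.exp (-(ζ ^ 2 / (4 * t)) - t) * t ^ (-1 - ν)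

/-- The normalizing constant `C_s = s 2^((2s-1)/2) / (π^(3/2) Γ(1-s))`. -/
def constC (s : ℝ) : ℝ :=
  s * 2 ^ ((2 * s - 1) / 2) / (Real.pi ^ (3 / 2 : ℝ) * Real.Gamma (1 - s))

/-- The fractional critical Sobolev exponent `2^*_s = 6 / (3 - 2s)` in dimension three. -/
def critExp (s : ℝ) : ℝ := 6 / (3 - 2 * s)

/-- The kernel `K_{(3+2s)/2}(m r) / r^((3+2s)/2)`, as a function of the distance `r`. -/
def kernel (s m r : ℝ) : ℝ :=
  besselK ((3 + 2 * s) / 2) (m * r) / r ^ ((3 + 2 * s) / 2)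

/-- The magnetic difference `e^{-i (x-y) · A((x+y)/2)} u(x) - u(y)`. -/
def magDiff (A : E3 → E3) (u : E3 → ℂ) (x y : E3) : ℂ :=
  Complex.exp (-Complex.I * ((inner ℝ (x - y) (A ((1 / 2 : ℝ) • (x + y))) : ℝ) : ℂ)) * u x - u y

/-- `⟨u, u⟩_{A,s}`, the square of the pseudorelativistic magnetic Gagliardo seminorm. -/
def gagliardoSq (s m : ℝ) (A : E3 → E3) (u : E3 → ℂ) : ℝ≥0∞ :=
  ∫⁻ p : E3 × E3, ‖magDiff A u p.1 p.2‖ₑ ^ 2 * ENNReal.ofReal (kernel s m ‖p.1 - p.2‖)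

/-- `(u, u)_{A,s} = (C_s / 2) m^((3+2s)/2) ⟨u, u⟩_{A,s} + m^(2s) ‖u‖²_{L²}`, in `[0, ∞]`. -/
def normSq (s m : ℝ) (A : E3 → E3) (u : E3 → ℂ) : ℝ≥0∞ :=
  ENNReal.ofReal (constC s / 2 * m ^ ((3 + 2 * s) / 2)) * gagliardoSq s m A u +
    ENNReal.ofReal (m ^ (2 * s)) * ∫⁻ x : E3, ‖u x‖ₑ ^ 2

/-- The norm `‖u‖_{A,s} = √(u, u)_{A,s}`, with value `∞` when `(u, u)_{A,s} = ∞`. -/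
def magNorm (s m : ℝ) (A : E3 → E3) (u : E3 → ℂ) : ℝ≥0∞ :=
  normSq s m A u ^ (1 / 2 : ℝ)

/-- Membership in the ambient space of the (classes of) measurable `u : ℝ³ → ℂ` with
`(u, u)_{A,s} < ∞`. -/
def MemAmbient (s m : ℝ) (A : E3 → E3) (u : E3 → ℂ) : Prop :=
  AEStronglyMeasurable u (volume : Measure E3) ∧ normSq s m A u < (⊤ : ℝ≥0∞)

/-- Membership in `H^s_A(ℝ³, ℂ)`, the closure of `C_c^∞(ℝ³, ℂ)` in the ambient space for the norm
`‖·‖_{A,s}`. -/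
def MemHsA (s m : ℝ) (A : E3 → E3) (u : E3 → ℂ) : Prop :=
  MemAmbient s m A u ∧
    ∀ ε : ℝ≥0∞, 0 < ε → ∃ φ : E3 → ℂ, ContDiff ℝ ∞ φ ∧ HasCompactSupport φ ∧
      magNorm s m A (u - φ) < ε

/-- Membership in `L^q_loc(ℝ³, ℂ)`. -/
def MemLqLoc (q : ℝ) (u : E3 → ℂ) : Prop :=
  ∀ K : Set E3, IsCompact K → MemLp u (ENNReal.ofReal q) (volume.restrict K)

/-- Convergence in `L^q_loc(ℝ³, ℂ)`: convergence in `L^q(K)` for every compact `K`. -/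
def TendstoLqLoc (q : ℝ) (u : ℕ → E3 → ℂ) (v : E3 → ℂ) : Prop :=
  ∀ K : Set E3, IsCompact K →
    Tendsto (fun n => eLpNorm (u n - v) (ENNReal.ofReal q) (volume.restrict K)) atTop (𝓝 0)

/-- The inclusion `H^s_A(ℝ³, ℂ) ⊆ L^q(ℝ³, ℂ)` holds and is continuous (bounded). -/
def EmbedsContinuously (s m : ℝ) (A : E3 → E3) (q : ℝ) : Prop :=
  ∃ C : ℝ≥0, ∀ u : E3 → ℂ, MemHsA s m A u →
    MemLp u (ENNReal.ofReal q) (volume : Measure E3) ∧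
      eLpNorm u (ENNReal.ofReal q) (volume : Measure E3) ≤ C * magNorm s m A u

/-- The inclusion `H^s_A(ℝ³, ℂ) ⊆ L^q_loc(ℝ³, ℂ)` holds, is continuous, and is compact: every
bounded sequence of `H^s_A` has a subsequence that converges in `L^q_loc`. -/
def EmbedsCompactlyLoc (s m : ℝ) (A : E3 → E3) (q : ℝ) : Prop :=
  (∀ u : E3 → ℂ, MemHsA s m A u → MemLqLoc q u) ∧
  (∀ K : Set E3, IsCompact K → ∃ C : ℝ≥0, ∀ u : E3 → ℂ, MemHsA s m A u →
    eLpNorm u (ENNReal.ofReal q) (volume.restrict K) ≤ C * magNorm s m A u) ∧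
  (∀ u : ℕ → E3 → ℂ, (∀ n, MemHsA s m A (u n)) →
    (∃ M : ℝ≥0, ∀ n, magNorm s m A (u n) ≤ M) →
    ∃ (v : E3 → ℂ) (g : ℕ → ℕ), StrictMono g ∧ MemLqLoc q v ∧ TendstoLqLoc q (fun n => u (g n)) v)

end MagneticSobolev

end

namespace MagneticSobolev

/-! Near the origin the Bessel kernel dominates a multiple of `r ^ (-(3 + 2 * s))`, so the magnetic
norm controls `∫ localEnergy`, an unweighted `L²` mass plus a Gagliardo energy over pairs at
distance less than 1. Both embeddings are deduced from this quantity alone.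

Critical embedding: the magnetic phase has modulus one, so `|u(x)| ≤ |u(y)| + |magDiff|`. Averaging
over a ball of radius `r` bounds `|u(x)|` by `r^(s-3/2) ‖u‖_p + r^s V(x)`, where `p = critExp s` and
`V²` is the local energy. Optimizing in `r` and integrating gives `‖u‖_p^p ≤ C ‖u‖_p^(p-2) ∫ V²`.
Truncating `|u|` makes the norm finite, so that it can be cancelled; monotone convergence then
removes the truncation (`exists_lintegral_min_rpow_le`, `exists_eLpNorm_critExp_le`). Interpolation
with `L²` covers the exponents in between.

Compactness: on a compact set `A` is bounded, so `u` differs from its averages over balls of radius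
`r` by `O(r^s)` in `L²`, uniformly on bounded sequences (`eLpNorm_sub_setAverage_le`). Along a
weakly convergent subsequence these averages converge, which gives strong local `L²` convergence.
Interpolation with the critical bound carries it to every subcritical exponent. -/

/-! ### The Bessel kernel near the origin. -/

theorem besselK_integrand_integrableOn {ν ζ : ℝ} (hζ : 0 < ζ) :
    IntegrableOn (fun t : ℝ => Real.exp (-(ζ ^ 2 / (4 * t)) - t) * t ^ (-1 - ν))
      (Set.Ioi 0) := by
  -- With `n > ν`, the bound `e^(-x) ≤ n! / x^n` at `x = ζ²/(4t)` leaves a multiple of the Gamma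
  -- integrand of parameter `n - ν > 0`.
  obtain ⟨n, hn⟩ := exists_nat_gt ν
  have hG := (Real.GammaIntegral_convergent (s := (n : ℝ) - ν) (by linarith)).const_mul
    (n.factorial * (4 / ζ ^ 2) ^ n)
  refine Integrable.mono' hG ?_ ?_
  · refine (ContinuousOn.aestronglyMeasurable ?_ measurableSet_Ioi)
    intro t ht
    have ht : 0 < t := ht
    refine ContinuousAt.continuousWithinAt ?_
    refine ContinuousAt.mul ?_ (Real.continuousAt_rpow_const _ _ (Or.inl ht.ne'))
    have : (4 * t) ≠ 0 := by positivity
    fun_prop (disch := assumption)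
  · refine (ae_restrict_iff' measurableSet_Ioi).2 (Eventually.of_forall fun t ht => ?_)
    have ht : 0 < t := ht
    have hx : 0 ≤ ζ ^ 2 / (4 * t) := by positivity
    have h1 := Real.pow_div_factorial_le_exp _ hx n
    have h2 : Real.exp (-(ζ ^ 2 / (4 * t))) ≤ n.factorial * (4 / ζ ^ 2) ^ n * t ^ n := by
      rw [Real.exp_neg]
      refine (inv_anti₀ (by positivity) h1).trans (le_of_eq ?_)
      rw [inv_div, div_pow, div_pow, mul_pow]
      field_simp
    have h3 : t ^ ((n : ℝ) - ν - 1) = t ^ n * t ^ (-1 - ν) := by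
      rw [← Real.rpow_natCast, ← Real.rpow_add ht]; congr 1; ring
    rw [Real.norm_of_nonneg (by positivity), sub_eq_add_neg, Real.exp_add, h3]
    calc Real.exp (-(ζ ^ 2 / (4 * t))) * Real.exp (-t) * t ^ (-1 - ν)
        ≤ (n.factorial * (4 / ζ ^ 2) ^ n * t ^ n) * Real.exp (-t) * t ^ (-1 - ν) := by gcongr
      _ = _ := by ring

/-- The part of the integral over `ζ² < t ≤ 2ζ²` suffices: there the exponential is bounded below,
and the interval's length times the power of `t` has order `ζ^(-2ν)`. -/
theorem besselK_ge {ν ζ : ℝ} (hν : -1 ≤ ν) (hζ : 0 < ζ) :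
    Real.exp (-(1 / 4) - 2 * ζ ^ 2) * 2 ^ (-1 - ν) / 2 ^ (ν + 1) * ζ ^ (-ν) ≤ besselK ν ζ := by
  have hsq : 0 < ζ ^ 2 := by positivity
  have hI : Real.exp (-(1 / 4) - 2 * ζ ^ 2) * (2 * ζ ^ 2) ^ (-1 - ν) * ζ ^ 2 ≤
      ∫ t in Set.Ioi (0 : ℝ), Real.exp (-(ζ ^ 2 / (4 * t)) - t) * t ^ (-1 - ν) := by
    have hsub : Set.Ioc (ζ ^ 2) (2 * ζ ^ 2) ⊆ Set.Ioi 0 := fun t ht => hsq.trans ht.1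
    have hint := besselK_integrand_integrableOn (ν := ν) hζ
    calc Real.exp (-(1 / 4) - 2 * ζ ^ 2) * (2 * ζ ^ 2) ^ (-1 - ν) * ζ ^ 2
        = ∫ t in Set.Ioc (ζ ^ 2) (2 * ζ ^ 2),
            Real.exp (-(1 / 4) - 2 * ζ ^ 2) * (2 * ζ ^ 2) ^ (-1 - ν) := by
          rw [setIntegral_const, smul_eq_mul, Measure.real, Real.volume_Ioc,
            ENNReal.toReal_ofReal (by linarith)]
          ring
      _ ≤ ∫ t in Set.Ioc (ζ ^ 2) (2 * ζ ^ 2),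
            Real.exp (-(ζ ^ 2 / (4 * t)) - t) * t ^ (-1 - ν) := by
          refine setIntegral_mono_on (integrableOn_const (by simp)) (hint.mono_set hsub)
            measurableSet_Ioc fun t ht => ?_
          have ht0 : 0 < t := hsub ht
          have h1 : ζ ^ 2 / (4 * t) ≤ 1 / 4 := by
            rw [div_le_iff₀ (by positivity)]; linarith [ht.1]
          have h2 : (2 * ζ ^ 2) ^ (-1 - ν) ≤ t ^ (-1 - ν) :=
            Real.rpow_le_rpow_of_nonpos ht0 ht.2 (by linarith)
          have h3 : -(1 / 4) - 2 * ζ ^ 2 ≤ -(ζ ^ 2 / (4 * t)) - t := by linarith [ht.2]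
          gcongr
      _ ≤ _ := by
          refine setIntegral_mono_set hint ?_ (Eventually.of_forall hsub)
          refine (ae_restrict_iff' measurableSet_Ioi).2 (Eventually.of_forall fun t ht => ?_)
          have ht : 0 < t := ht
          simp only [Pi.zero_apply]
          positivity
  unfold besselK
  refine le_trans (le_of_eq ?_) (mul_le_mul_of_nonneg_left hI (by positivity))
  rw [Real.mul_rpow two_pos.le hsq.le, Real.div_rpow hζ.le two_pos.le, Real.rpow_add two_pos,
    Real.rpow_one]
  have h4 : ζ ^ ν * ((ζ ^ 2) ^ (-1 - ν) * ζ ^ 2) = ζ ^ (-ν) := by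
    rw [← Real.rpow_natCast, ← Real.rpow_mul hζ.le, ← Real.rpow_add hζ, ← Real.rpow_add hζ]
    congr 1; push_cast; ring
  rw [← h4]
  field_simp

theorem exists_kernel_ge {s m : ℝ} (hs0 : 0 < s) (hm : 0 < m) :
    ∃ c : ℝ, 0 < c ∧ ∀ r : ℝ, 0 < r → r < 1 → c * r ^ (-(3 + 2 * s)) ≤ kernel s m r := by
  set ν := (3 + 2 * s) / 2 with hν
  refine ⟨Real.exp (-(1 / 4) - 2 * m ^ 2) * 2 ^ (-1 - ν) / 2 ^ (ν + 1) * m ^ (-ν),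
    by positivity, fun r hr0 hr1 => ?_⟩
  have h1 := besselK_ge (ν := ν) (ζ := m * r) (by rw [hν]; linarith) (by positivity)
  unfold kernel
  rw [← hν, le_div_iff₀ (by positivity)]
  refine le_trans ?_ h1
  rw [Real.mul_rpow hm.le hr0.le]
  have h2 : r ^ (-(3 + 2 * s)) * r ^ ν = r ^ (-ν) := by
    rw [← Real.rpow_add hr0]; congr 1; rw [hν]; ring
  have h3 : (m * r) ^ 2 ≤ m ^ 2 := by
    rw [mul_pow]; exact mul_le_of_le_one_right (by positivity) (by nlinarith)
  rw [mul_assoc, h2]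
  rw [mul_assoc (_ / _)]
  gcongr

theorem constC_pos {s : ℝ} (hs0 : 0 < s) (hs1 : s < 1) : 0 < constC s := by
  have : 0 < Real.Gamma (1 - s) := Real.Gamma_pos_of_pos (by linarith)
  unfold constC
  positivity

/-! ### Local energy and its control by the magnetic norm. -/

/-- The local energy density of `u` at `x`. -/
noncomputable def localEnergy (s : ℝ) (A : E3 → E3) (u : E3 → ℂ) (x : E3) : ℝ≥0∞ :=
  (∫⁻ y in Metric.ball x 1, ‖magDiff A u x y‖ₑ ^ 2 * ENNReal.ofReal (‖x - y‖ ^ (-(3 + 2 * s)))) +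
    ‖u x‖ₑ ^ 2

theorem magDiff_self (A : E3 → E3) (u : E3 → ℂ) (x : E3) : magDiff A u x x = 0 := by
  simp [magDiff]

theorem aestronglyMeasurable_magDiff {A : E3 → E3} (hA : Continuous A) {u : E3 → ℂ}
    (hu : AEStronglyMeasurable u volume) :
    AEStronglyMeasurable (fun p : E3 × E3 => magDiff A u p.1 p.2)
      ((volume : Measure E3).prod volume) := by
  unfold magDiff
  refine (AEStronglyMeasurable.mul ?_ hu.comp_fst).sub hu.comp_snd
  exact Continuous.aestronglyMeasurable (by fun_prop)

theorem aestronglyMeasurable_magDiff_right {A : E3 → E3} (hA : Continuous A) {u : E3 → ℂ}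
    (hu : AEStronglyMeasurable u volume) (x : E3) :
    AEStronglyMeasurable (fun y : E3 => magDiff A u x y) volume := by
  unfold magDiff
  refine (AEStronglyMeasurable.mul ?_ aestronglyMeasurable_const).sub hu
  exact Continuous.aestronglyMeasurable (by fun_prop)

theorem aemeasurable_indicator_energy (s : ℝ) {A : E3 → E3} (hA : Continuous A) {u : E3 → ℂ}
    (hu : AEStronglyMeasurable u volume) :
    AEMeasurable ({p : E3 × E3 | p.2 ∈ Metric.ball p.1 1}.indicator fun p : E3 × E3 =>
      ‖magDiff A u p.1 p.2‖ₑ ^ 2 * ENNReal.ofReal (‖p.1 - p.2‖ ^ (-(3 + 2 * s))))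
      ((volume : Measure E3).prod volume) := by
  refine AEMeasurable.indicator ?_ ?_
  · refine ((aestronglyMeasurable_magDiff hA hu).enorm.pow_const 2).mul ?_
    fun_prop
  · exact (isOpen_lt (by fun_prop) continuous_const :
      IsOpen {p : E3 × E3 | dist p.2 p.1 < 1}).measurableSet

theorem localEnergy_eq (s : ℝ) (A : E3 → E3) (u : E3 → ℂ) (x : E3) :
    localEnergy s A u x = (∫⁻ y, ({p : E3 × E3 | p.2 ∈ Metric.ball p.1 1}.indicator
      fun p : E3 × E3 => ‖magDiff A u p.1 p.2‖ₑ ^ 2 *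
        ENNReal.ofReal (‖p.1 - p.2‖ ^ (-(3 + 2 * s)))) (x, y)) + ‖u x‖ₑ ^ 2 := by
  unfold localEnergy
  rw [← lintegral_indicator measurableSet_ball]
  rfl

theorem aemeasurable_localEnergy (s : ℝ) {A : E3 → E3} (hA : Continuous A) {u : E3 → ℂ}
    (hu : AEStronglyMeasurable u volume) : AEMeasurable (localEnergy s A u) volume := by
  rw [show localEnergy s A u = _ from funext (localEnergy_eq s A u)]
  exact (aemeasurable_indicator_energy s hA hu).lintegral_prod_right'.add (hu.enorm.pow_const 2)

/-- The total local energy is controlled by the pseudorelativistic magnetic norm. -/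
theorem exists_lintegral_localEnergy_le {s m : ℝ} (hs0 : 0 < s) (hs1 : s < 1) (hm : 0 < m)
    {A : E3 → E3} (hA : Continuous A) :
    ∃ C : ℝ≥0, ∀ u : E3 → ℂ, AEStronglyMeasurable u volume →
      ∫⁻ x, localEnergy s A u x ≤ C * normSq s m A u := by
  obtain ⟨c, hc, hk⟩ := exists_kernel_ge hs0 hm
  have hκ : 0 < constC s / 2 * m ^ ((3 + 2 * s) / 2) := by
    have := constC_pos hs0 hs1
    positivity
  have hμ : 0 < m ^ (2 * s) := by positivity
  unfold normSq
  set κ := constC s / 2 * m ^ ((3 + 2 * s) / 2)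
  set μ := m ^ (2 * s)
  refine ⟨(c⁻¹ * κ⁻¹).toNNReal + (μ⁻¹).toNNReal, fun u hu => ?_⟩
  have hF := aemeasurable_indicator_energy s hA hu
  have h1 : ∫⁻ x, localEnergy s A u x ≤ ENNReal.ofReal c⁻¹ * gagliardoSq s m A u +
      ∫⁻ x, ‖u x‖ₑ ^ 2 := by
    simp_rw [localEnergy_eq]
    rw [lintegral_add_right' _ (hu.enorm.pow_const 2), ← lintegral_prod _ hF]
    gcongr
    unfold gagliardoSq
    rw [← lintegral_const_mul' _ _ ENNReal.ofReal_ne_top, Measure.volume_eq_prod]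
    refine lintegral_mono fun p => ?_
    refine Set.indicator_apply_le' (fun hp => ?_) (fun _ => zero_le)
    rw [mul_left_comm, ← ENNReal.ofReal_mul (by positivity)]
    have hp : dist p.2 p.1 < 1 := hp
    gcongr
    -- On the diagonal both weights take the default value 0: zero to a nonzero power, and division
    -- by zero.
    rcases eq_or_ne p.1 p.2 with h | h
    · rw [h, sub_self, norm_zero, Real.zero_rpow (by linarith)]
      simp [kernel, Real.zero_rpow (by positivity : (3 + 2 * s) / 2 ≠ 0)]
    · rw [dist_comm, dist_eq_norm] at hp
      have := hk ‖p.1 - p.2‖ (norm_pos_iff.2 (sub_ne_zero.2 h)) hp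
      rw [inv_mul_eq_div, le_div_iff₀ hc]
      linarith
  refine h1.trans ?_
  rw [ENNReal.coe_add, mul_add, add_mul, add_mul]
  change _ ≤ (ENNReal.ofReal _ * _ + ENNReal.ofReal _ * _) +
    (ENNReal.ofReal _ * _ + ENNReal.ofReal _ * _)
  rw [← mul_assoc, ← mul_assoc, ← mul_assoc, ← mul_assoc, ← ENNReal.ofReal_mul (by positivity),
    ← ENNReal.ofReal_mul (by positivity), ← ENNReal.ofReal_mul (by positivity),
    ← ENNReal.ofReal_mul (by positivity), mul_assoc c⁻¹, inv_mul_cancel₀ hκ.ne', mul_one,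
    inv_mul_cancel₀ hμ.ne', ENNReal.ofReal_one, one_mul]
  exact add_le_add le_self_add le_add_self

theorem enorm_sq_le_localEnergy (s : ℝ) (A : E3 → E3) (u : E3 → ℂ) (x : E3) :
    ‖u x‖ₑ ^ 2 ≤ localEnergy s A u x := le_add_self

/-! ### Mean values over small balls. -/

theorem lintegral_le_rpow_mul_measure_univ {α : Type*} [MeasurableSpace α] {μ : Measure α}
    {f : α → ℝ≥0∞} (hf : AEMeasurable f μ) {p : ℝ} (hp : 1 ≤ p) :
    ∫⁻ x, f x ∂μ ≤ (∫⁻ x, f x ^ p ∂μ) ^ (1 / p) * μ Set.univ ^ (1 - 1 / p) := by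
  have hp0 : 0 < p := by linarith
  have h := ENNReal.lintegral_mul_norm_pow_le (hf.pow_const p)
    (aemeasurable_const (b := (1 : ℝ≥0∞)) (μ := μ)) (p := 1 / p) (q := 1 - 1 / p) (by positivity)
    (by rw [sub_nonneg, div_le_one hp0]; exact hp) (by ring)
  simpa [← ENNReal.rpow_mul, mul_inv_cancel₀ hp0.ne'] using h

/-- Cauchy–Schwarz, then insertion of the weight `(r / |x - y|)^(3+2s) ≥ 1`, valid off the diagonal;
on it `magDiff` vanishes. -/
theorem lintegral_ball_magDiff_le {s : ℝ} (hs0 : 0 < s) {A : E3 → E3} (hA : Continuous A)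
    {u : E3 → ℂ} (hu : AEStronglyMeasurable u volume) (x : E3) {r : ℝ} (hr0 : 0 < r)
    (hr1 : r ≤ 1) :
    ∫⁻ y in Metric.ball x r, ‖magDiff A u x y‖ₑ ≤
      ENNReal.ofReal (r ^ (3 / 2 + s)) * localEnergy s A u x ^ (1 / 2 : ℝ) *
        volume (Metric.ball x r) ^ (1 / 2 : ℝ) := by
  have h1 := lintegral_le_rpow_mul_measure_univ (p := 2)
    (aestronglyMeasurable_magDiff_right hA hu x).enorm.restrict (by norm_num)
      (μ := volume.restrict (Metric.ball x r))
  rw [Measure.restrict_apply_univ, show (1 - 1 / 2 : ℝ) = 1 / 2 by norm_num] at h1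
  refine h1.trans ?_
  gcongr
  have h2 : ENNReal.ofReal (r ^ (3 / 2 + s)) = ENNReal.ofReal (r ^ (3 + 2 * s)) ^ (1 / 2 : ℝ) := by
    rw [ENNReal.ofReal_rpow_of_nonneg (by positivity) (by positivity), ← Real.rpow_mul hr0.le]
    congr 2; ring
  rw [h2, ← ENNReal.mul_rpow_of_nonneg _ _ (by positivity)]
  gcongr
  have h3 : ∫⁻ y in Metric.ball x r, ‖magDiff A u x y‖ₑ ^ (2 : ℝ) ≤
      ∫⁻ y in Metric.ball x r, ENNReal.ofReal (r ^ (3 + 2 * s)) *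
        (‖magDiff A u x y‖ₑ ^ 2 * ENNReal.ofReal (‖x - y‖ ^ (-(3 + 2 * s)))) := by
    refine setLIntegral_mono' measurableSet_ball fun y hy => ?_
    rw [ENNReal.rpow_two, mul_left_comm]
    rcases eq_or_ne x y with h | h
    · simp [h, magDiff_self]
    · rw [← ENNReal.ofReal_mul (by positivity)]
      refine le_mul_of_one_le_right zero_le ?_
      rw [ENNReal.one_le_ofReal, Real.rpow_neg (norm_nonneg _), ← div_eq_mul_inv,
        one_le_div (by have := norm_pos_iff.2 (sub_ne_zero.2 h); positivity)]
      rw [Metric.mem_ball, dist_comm, dist_eq_norm] at hy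
      gcongr
  refine h3.trans ?_
  rw [lintegral_const_mul' _ _ ENNReal.ofReal_ne_top]
  gcongr
  refine le_trans ?_ (le_self_add (a := _) (b := ‖u x‖ₑ ^ 2))
  exact lintegral_mono_set (Metric.ball_subset_ball hr1)

theorem two_lt_critExp {s : ℝ} (hs0 : 0 < s) (hs1 : s < 1) : 2 < critExp s := by
  unfold critExp
  rw [lt_div_iff₀ (by linarith)]
  linarith

theorem inv_critExp (s : ℝ) : 1 / critExp s = (3 - 2 * s) / 6 := by
  rw [critExp, one_div_div]

theorem volume_ball_ne_zero {r : ℝ} (hr : 0 < r) (x : E3) : volume (Metric.ball x r) ≠ 0 :=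
  (Metric.measure_ball_pos volume x hr).ne'

theorem volume_ball_eq_ofReal {r : ℝ} (hr : 0 < r) (x : E3) :
    volume (Metric.ball x r) =
      ENNReal.ofReal (r ^ (3 : ℝ) * volume.real (Metric.ball (0 : E3) 1)) := by
  rw [Measure.addHaar_ball _ _ hr.le, ENNReal.ofReal_mul (by positivity), ofReal_measureReal]
  simp [finrank_euclideanSpace]

theorem volume_real_ball_pos : 0 < volume.real (Metric.ball (0 : E3) 1) :=
  ENNReal.toReal_pos (volume_ball_ne_zero one_pos 0) measure_ball_lt_top.ne

theorem volume_ball_rpow {r : ℝ} (hr : 0 < r) (x : E3) (a : ℝ) :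
    volume (Metric.ball x r) ^ a =
      ENNReal.ofReal (volume.real (Metric.ball (0 : E3) 1) ^ a) * ENNReal.ofReal (r ^ (3 * a)) := by
  have := volume_real_ball_pos
  rw [volume_ball_eq_ofReal hr, ENNReal.ofReal_rpow_of_pos (by positivity),
    Real.mul_rpow (by positivity) this.le, ← Real.rpow_mul hr.le, mul_comm,
    ENNReal.ofReal_mul (by positivity)]

theorem inv_volume_ball_mul_rpow {r : ℝ} (hr : 0 < r) (x : E3) (a : ℝ) :
    (volume (Metric.ball x r))⁻¹ * volume (Metric.ball x r) ^ a =
      ENNReal.ofReal (volume.real (Metric.ball (0 : E3) 1) ^ (a - 1)) *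
        ENNReal.ofReal (r ^ (3 * (a - 1))) := by
  rw [← volume_ball_rpow hr x, ← ENNReal.rpow_neg_one,
    ← ENNReal.rpow_add _ _ (volume_ball_ne_zero hr x) measure_ball_lt_top.ne]
  congr 1; ring

theorem inv_volume_ball_mul_lintegral_magDiff_le {s : ℝ} (hs0 : 0 < s) {A : E3 → E3}
    (hA : Continuous A) {u : E3 → ℂ} (hu : AEStronglyMeasurable u volume) (x : E3) {r : ℝ}
    (hr0 : 0 < r) (hr1 : r ≤ 1) :
    (volume (Metric.ball x r))⁻¹ * ∫⁻ y in Metric.ball x r, ‖magDiff A u x y‖ₑ ≤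
      ENNReal.ofReal (volume.real (Metric.ball (0 : E3) 1) ^ (-(1 / 2) : ℝ)) *
        (ENNReal.ofReal (r ^ s) * localEnergy s A u x ^ (1 / 2 : ℝ)) := by
  have h := mul_le_mul_right (lintegral_ball_magDiff_le hs0 hA hu x hr0 hr1)
    (volume (Metric.ball x r))⁻¹
  refine h.trans (le_of_eq ?_)
  rw [mul_left_comm, inv_volume_ball_mul_rpow hr0, show (1 / 2 - 1 : ℝ) = -(1 / 2) by norm_num,
    show r ^ s = r ^ (3 / 2 + s) * r ^ (3 * -(1 / 2) : ℝ) by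
      rw [← Real.rpow_add hr0]; congr 1; ring,
    ENNReal.ofReal_mul (by positivity)]
  ring

/-- A pointwise diamagnetic inequality: the phase is unimodular, so it disappears whatever the size
of `A`. -/
theorem enorm_le_enorm_add_magDiff (A : E3 → E3) (u : E3 → ℂ) (x y : E3) :
    ‖u x‖ₑ ≤ ‖u y‖ₑ + ‖magDiff A u x y‖ₑ := by
  set θ : ℝ := inner ℝ (x - y) (A ((1 / 2 : ℝ) • (x + y))) with hθ
  have h1 : ‖Complex.exp (-Complex.I * (θ : ℂ))‖ = 1 := by
    rw [show -Complex.I * (θ : ℂ) = ((-θ : ℝ) : ℂ) * Complex.I by push_cast; ring]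
    exact Complex.norm_exp_ofReal_mul_I _
  have h2 : ‖u x‖ₑ = ‖Complex.exp (-Complex.I * (θ : ℂ)) * u x‖ₑ := by
    rw [← ofReal_norm, ← ofReal_norm, norm_mul, h1, one_mul]
  rw [h2]
  calc _ = ‖u y + magDiff A u x y‖ₑ := by rw [magDiff]; congr 1; ring
    _ ≤ _ := enorm_add_le _ _

/-! ### The critical Sobolev inequality. -/

/-- Truncation of `|u|` at height `N` is controlled by averages at every scale. -/
theorem exists_min_enorm_le {s : ℝ} (hs0 : 0 < s) (hs1 : s < 1) :
    ∃ K : ℝ, 0 < K ∧ ∀ (A : E3 → E3) (_ : Continuous A) (u : E3 → ℂ)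
      (_ : AEStronglyMeasurable u volume) (N : ℝ≥0∞) (x : E3) (r : ℝ), 0 < r →
      min ‖u x‖ₑ N ≤ ENNReal.ofReal K *
        (ENNReal.ofReal (r ^ (s - 3 / 2)) *
            (∫⁻ y, min ‖u y‖ₑ N ^ critExp s) ^ (1 / critExp s) +
          ENNReal.ofReal (r ^ s) * localEnergy s A u x ^ (1 / 2 : ℝ)) := by
  set b₁ := volume.real (Metric.ball (0 : E3) 1) with hb₁
  have hb₁0 : 0 < b₁ := volume_real_ball_pos
  have hp := two_lt_critExp hs0 hs1
  -- The three terms serve, in order, the radii above 1, the Hölder bound for the mean of the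
  -- truncation, and the mean of `magDiff`.
  set K := 1 + b₁ ^ (-(1 / critExp s)) + b₁ ^ (-(1 / 2) : ℝ)
  have ha : 0 < b₁ ^ (-(1 / critExp s)) := by positivity
  have hb : 0 < b₁ ^ (-(1 / 2) : ℝ) := by positivity
  refine ⟨K, by positivity, fun A hA u hu N x r hr0 => ?_⟩
  set V := localEnergy s A u x ^ (1 / 2 : ℝ)
  set F := (∫⁻ y, min ‖u y‖ₑ N ^ critExp s) ^ (1 / critExp s)
  rw [mul_add]
  rcases le_or_gt r 1 with hr1 | hr1
  · have hB := volume_ball_ne_zero hr0 x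
    have hB' : volume (Metric.ball x r) ≠ ⊤ := measure_ball_lt_top.ne
    have hmeas : AEMeasurable (fun y => min ‖u y‖ₑ N) volume := hu.enorm.min aemeasurable_const
    have h1 : min ‖u x‖ₑ N * volume (Metric.ball x r) ≤
        F * volume (Metric.ball x r) ^ (1 - 1 / critExp s) +
          ∫⁻ y in Metric.ball x r, ‖magDiff A u x y‖ₑ := by
      calc min ‖u x‖ₑ N * volume (Metric.ball x r)
          = ∫⁻ _ in Metric.ball x r, min ‖u x‖ₑ N := by rw [setLIntegral_const]
        _ ≤ ∫⁻ y in Metric.ball x r, (min ‖u y‖ₑ N + ‖magDiff A u x y‖ₑ) := by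
            refine lintegral_mono fun y => ?_
            have h := enorm_le_enorm_add_magDiff A u x y
            rcases le_total ‖u y‖ₑ N with h' | h'
            · rw [min_eq_left h']; exact (min_le_left _ _).trans h
            · rw [min_eq_right h']; exact (min_le_right _ _).trans le_self_add
        _ = (∫⁻ y in Metric.ball x r, min ‖u y‖ₑ N) +
            ∫⁻ y in Metric.ball x r, ‖magDiff A u x y‖ₑ := lintegral_add_left' hmeas.restrict _
        _ ≤ _ := by
            gcongr
            refine (lintegral_le_rpow_mul_measure_univ hmeas.restrict
              (by linarith : 1 ≤ critExp s)).trans ?_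
            rw [Measure.restrict_apply_univ]
            gcongr
            exact ENNReal.rpow_le_rpow (lintegral_mono' Measure.restrict_le_self le_rfl)
              (by positivity)
    have h2 : min ‖u x‖ₑ N = (volume (Metric.ball x r))⁻¹ *
        (min ‖u x‖ₑ N * volume (Metric.ball x r)) := by
      rw [mul_left_comm, ENNReal.inv_mul_cancel hB hB', mul_one]
    rw [h2]
    refine (mul_le_mul_right h1 _).trans ?_
    rw [mul_add]
    refine add_le_add ?_ ?_
    · rw [mul_left_comm, inv_volume_ball_mul_rpow hr0, ← hb₁,
        show (1 - 1 / critExp s - 1) = -(1 / critExp s) by ring,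
        show 3 * (-(1 / critExp s)) = s - 3 / 2 by rw [inv_critExp]; ring, mul_comm F, mul_assoc]
      gcongr
      linarith
    · refine (inv_volume_ball_mul_lintegral_magDiff_le hs0 hA hu x hr0 hr1).trans ?_
      gcongr
      linarith
  -- For `r > 1` the term `|u(x)|²` in the local energy is already enough. All radii are thus
  -- admissible in the later optimization.
  · refine le_trans ?_ le_add_self
    have h1 : min ‖u x‖ₑ N ≤ V := by
      refine (min_le_left _ _).trans ?_
      change _ ≤ localEnergy s A u x ^ (1 / 2 : ℝ)
      rw [one_div, ENNReal.le_rpow_inv_iff two_pos, ENNReal.rpow_two]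
      exact enorm_sq_le_localEnergy s A u x
    refine h1.trans ?_
    rw [← mul_assoc, ← ENNReal.ofReal_mul (by positivity)]
    refine le_mul_of_one_le_left zero_le ?_
    rw [ENNReal.one_le_ofReal]
    have := Real.one_le_rpow hr1.le hs0.le
    nlinarith

/-- The choice `r = (F/V)^(2/3)` makes the two terms equal to `F^(2s/3) V^(1-2s/3)`. Raised to the
critical exponent `p`, these powers become exactly `p - 2` and 2. -/
theorem rpow_critExp_le_of_forall {s : ℝ} (hs0 : 0 < s) (hs1 : s < 1) {K a F V : ℝ}
    (hK : 0 < K) (ha : 0 ≤ a) (hF : 0 < F) (hV : 0 < V)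
    (h : ∀ r : ℝ, 0 < r → a ≤ K * (r ^ (s - 3 / 2) * F + r ^ s * V)) :
    a ^ critExp s ≤ (2 * K) ^ critExp s * F ^ (critExp s - 2) * V ^ 2 := by
  have hp := two_lt_critExp hs0 hs1
  have h1 := h ((F / V) ^ (2 / 3 : ℝ)) (by positivity)
  have hFV : 0 < F / V := by positivity
  have e1 : ((F / V) ^ (2 / 3 : ℝ)) ^ (s - 3 / 2) * F = F ^ (2 * s / 3) * V ^ (1 - 2 * s / 3) := by
    rw [← Real.rpow_mul hFV.le, Real.div_rpow hF.le hV.le, div_eq_mul_inv, ← Real.rpow_neg hV.le,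
      mul_right_comm]
    nth_rewrite 2 [← Real.rpow_one F]
    rw [← Real.rpow_add hF]
    congr 2 <;> ring
  have e2 : ((F / V) ^ (2 / 3 : ℝ)) ^ s * V = F ^ (2 * s / 3) * V ^ (1 - 2 * s / 3) := by
    rw [← Real.rpow_mul hFV.le, Real.div_rpow hF.le hV.le, div_eq_mul_inv, ← Real.rpow_neg hV.le,
      mul_assoc]
    nth_rewrite 2 [← Real.rpow_one V]
    rw [← Real.rpow_add hV]
    congr 2 <;> ring
  rw [e1, e2, ← two_mul, ← mul_assoc, mul_comm K] at h1
  have h2 := Real.rpow_le_rpow ha h1 (by linarith : 0 ≤ critExp s)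
  refine h2.trans (le_of_eq ?_)
  have h3 : 3 - 2 * s ≠ 0 := by linarith
  rw [Real.mul_rpow (x := 2 * K) (by positivity) (by positivity),
    Real.mul_rpow (x := F ^ _) (by positivity) (by positivity),
    ← Real.rpow_mul hF.le, ← Real.rpow_mul hV.le, ← mul_assoc, ← Real.rpow_natCast V 2]
  congr 2
  · congr 1
    unfold critExp; field_simp; ring
  · unfold critExp; field_simp; push_cast; ring

/-- Fractional Sobolev inequality for truncations. -/
theorem exists_lintegral_min_rpow_le {s : ℝ} (hs0 : 0 < s) (hs1 : s < 1) :
    ∃ C : ℝ≥0, ∀ (A : E3 → E3) (_ : Continuous A) (u : E3 → ℂ)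
      (_ : AEStronglyMeasurable u volume) (N : ℝ≥0∞), N ≠ ⊤ →
      (∫⁻ y, min ‖u y‖ₑ N ^ critExp s) ^ (1 / critExp s) ≤
        C * (∫⁻ x, localEnergy s A u x) ^ (1 / 2 : ℝ) := by
  obtain ⟨K, hK, hmin⟩ := exists_min_enorm_le hs0 hs1
  have hp := two_lt_critExp hs0 hs1
  set p := critExp s with hp_def
  -- The summand 1 keeps the constant visibly nonzero, so that its product with an infinite energy
  -- is infinite.
  refine ⟨1 + ((2 * K) ^ (p / 2)).toNNReal, fun A hA u hu N hN => ?_⟩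
  set E := ∫⁻ x, localEnergy s A u x with hE_def
  rcases eq_or_ne E ⊤ with hE | hE
  · rw [hE, ENNReal.top_rpow_of_pos (by norm_num), ENNReal.mul_top]
    · exact le_top
    · simp
  have hmeas : AEMeasurable (fun y => min ‖u y‖ₑ N) volume := hu.enorm.min aemeasurable_const
  set I := ∫⁻ y, min ‖u y‖ₑ N ^ p with hI_def
  -- This is where truncation is needed: `min(|u|, N)^p ≤ N^(p-2) |u|²` is integrable, which later
  -- permits division by `F ^ (p - 2)`.
  have hI : I ≠ ⊤ := by
    have h1 : I ≤ ∫⁻ y, N ^ (p - 2) * localEnergy s A u y := by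
      refine lintegral_mono fun y => ?_
      calc min ‖u y‖ₑ N ^ p = min ‖u y‖ₑ N ^ (p - 2) * min ‖u y‖ₑ N ^ (2 : ℝ) := by
            rw [← ENNReal.rpow_add_of_nonneg _ _ (by linarith) (by norm_num)]; congr 1; ring
        _ ≤ N ^ (p - 2) * ‖u y‖ₑ ^ (2 : ℝ) := by
            gcongr
            · exact min_le_right _ _
            · exact min_le_left _ _
        _ ≤ _ := by
            rw [ENNReal.rpow_two]; gcongr; exact enorm_sq_le_localEnergy s A u y
    have h2 : N ^ (p - 2) ≠ ⊤ := ENNReal.rpow_ne_top_of_nonneg (by linarith) hN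
    rw [lintegral_const_mul' _ _ h2] at h1
    exact (h1.trans_lt (ENNReal.mul_lt_top h2.lt_top hE.lt_top)).ne
  rcases eq_or_ne I 0 with hI0 | hI0
  · rw [hI0, ENNReal.zero_rpow_of_pos (by positivity)]; exact zero_le
  set F := (I ^ (1 / p)).toReal with hF_def
  have hIp : I ^ (1 / p) ≠ ⊤ := ENNReal.rpow_ne_top_of_nonneg (by positivity) hI
  have hF : 0 < F := ENNReal.toReal_pos
    (by simp [ENNReal.rpow_eq_zero_iff, hI0, hI]) hIp
  have hFI : ENNReal.ofReal F = I ^ (1 / p) := ENNReal.ofReal_toReal hIp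
  have hFI' : ENNReal.ofReal (F ^ p) = I := by
    rw [← ENNReal.ofReal_rpow_of_pos hF, hFI, ← ENNReal.rpow_mul, one_div,
      inv_mul_cancel₀ (by linarith), ENNReal.rpow_one]
  have hpt : ∀ᵐ x, min ‖u x‖ₑ N ^ p ≤
      ENNReal.ofReal ((2 * K) ^ p * F ^ (p - 2)) * localEnergy s A u x := by
    filter_upwards [ae_lt_top' (aemeasurable_localEnergy s hA hu) hE] with x hx
    set L := localEnergy s A u x
    have hL := enorm_sq_le_localEnergy s A u x
    have ha : min ‖u x‖ₑ N ≠ ⊤ := ((min_le_right _ _).trans_lt hN.lt_top).ne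
    rcases eq_or_ne L 0 with hL0 | hL0
    · have h0 : min ‖u x‖ₑ N = 0 := by
        have h1 : ‖u x‖ₑ ^ 2 = 0 := le_antisymm (hL.trans hL0.le) zero_le
        rw [pow_eq_zero_iff two_ne_zero] at h1
        rw [h1]; exact min_eq_left zero_le
      rw [h0, ENNReal.zero_rpow_of_pos (by linarith)]; exact zero_le
    have hLh : L ^ (1 / 2 : ℝ) ≠ ⊤ := ENNReal.rpow_ne_top_of_nonneg (by norm_num) hx.ne
    set V := (L ^ (1 / 2 : ℝ)).toReal with hV_def
    have hV : 0 < V := ENNReal.toReal_pos (by simp [ENNReal.rpow_eq_zero_iff, hL0]) hLh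
    have hVL : ENNReal.ofReal V = L ^ (1 / 2 : ℝ) := ENNReal.ofReal_toReal hLh
    have hVL' : ENNReal.ofReal (V ^ 2) = L := by
      rw [ENNReal.ofReal_pow hV.le, hVL, ← ENNReal.rpow_two, ← ENNReal.rpow_mul]; norm_num
    have h1 := rpow_critExp_le_of_forall hs0 hs1 hK (ENNReal.toReal_nonneg) hF hV
      (a := (min ‖u x‖ₑ N).toReal) fun r hr => by
        refine ENNReal.toReal_le_of_le_ofReal (by positivity) ?_
        refine (hmin A hA u hu N x r hr).trans (le_of_eq ?_)
        rw [ENNReal.ofReal_mul hK.le, ENNReal.ofReal_add (by positivity) (by positivity),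
          ENNReal.ofReal_mul (by positivity), ENNReal.ofReal_mul (by positivity), hFI, hVL]
    have h2 := ENNReal.ofReal_le_ofReal h1
    rwa [← ENNReal.ofReal_rpow_of_nonneg ENNReal.toReal_nonneg (by linarith),
      ENNReal.ofReal_toReal ha, ENNReal.ofReal_mul (by positivity), hVL'] at h2
  have hint : I ≤ ENNReal.ofReal ((2 * K) ^ p * F ^ (p - 2)) * E := by
    refine (lintegral_mono_ae hpt).trans (le_of_eq ?_)
    rw [lintegral_const_mul' _ _ ENNReal.ofReal_ne_top]
  have hreal : F ^ p ≤ (2 * K) ^ p * F ^ (p - 2) * E.toReal := by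
    rw [← ENNReal.ofReal_le_ofReal_iff (by positivity), ENNReal.ofReal_mul (by positivity),
      ENNReal.ofReal_toReal hE, hFI']
    exact hint
  have hsq : F ^ 2 ≤ (2 * K) ^ p * E.toReal := by
    have h1 : F ^ p = F ^ 2 * F ^ (p - 2) := by
      rw [← Real.rpow_natCast F 2, ← Real.rpow_add hF]; congr 1; push_cast; ring
    rw [h1, mul_right_comm] at hreal
    exact le_of_mul_le_mul_right hreal (by positivity)
  rw [← hFI]
  have h1 : F ≤ (2 * K) ^ (p / 2) * E.toReal ^ (1 / 2 : ℝ) := by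
    rw [show (2 * K) ^ (p / 2) = ((2 * K) ^ p) ^ (1 / 2 : ℝ) by
      rw [← Real.rpow_mul (by positivity)]; congr 1; ring,
      ← Real.mul_rpow (by positivity) ENNReal.toReal_nonneg, ← Real.sqrt_eq_rpow]
    exact Real.le_sqrt_of_sq_le hsq
  refine (ENNReal.ofReal_le_ofReal h1).trans ?_
  rw [ENNReal.ofReal_mul (by positivity),
    ← ENNReal.ofReal_rpow_of_nonneg ENNReal.toReal_nonneg (by norm_num), ENNReal.ofReal_toReal hE]
  gcongr
  rw [ENNReal.coe_add]
  exact le_add_self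

/-- The magnetic fractional Sobolev inequality at the critical exponent. -/
theorem exists_eLpNorm_critExp_le {s : ℝ} (hs0 : 0 < s) (hs1 : s < 1) :
    ∃ C : ℝ≥0, ∀ (A : E3 → E3) (_ : Continuous A) (u : E3 → ℂ)
      (_ : AEStronglyMeasurable u volume),
      eLpNorm u (ENNReal.ofReal (critExp s)) volume ≤
        C * (∫⁻ x, localEnergy s A u x) ^ (1 / 2 : ℝ) := by
  obtain ⟨C, hC⟩ := exists_lintegral_min_rpow_le hs0 hs1
  have hp := two_lt_critExp hs0 hs1
  refine ⟨C, fun A hA u hu => ?_⟩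
  rw [eLpNorm_eq_lintegral_rpow_enorm_toReal (by simp; linarith) ENNReal.ofReal_ne_top,
    ENNReal.toReal_ofReal (by linarith)]
  have hlim : Tendsto (fun N : ℕ => ∫⁻ y, min ‖u y‖ₑ (N : ℝ≥0∞) ^ critExp s) atTop
      (𝓝 (∫⁻ y, ‖u y‖ₑ ^ critExp s)) := by
    refine lintegral_tendsto_of_tendsto_of_monotone
      (fun N => (hu.enorm.min aemeasurable_const).pow_const _)
      (Eventually.of_forall fun y N N' hN => ?_) (Eventually.of_forall fun y => ?_)
    · have : (N : ℝ≥0∞) ≤ N' := by exact_mod_cast hN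
      dsimp only
      gcongr
    · refine (ENNReal.continuous_rpow_const.tendsto _).comp ?_
      have := (tendsto_const_nhds (x := ‖u y‖ₑ)).min ENNReal.tendsto_nat_nhds_top
      rwa [min_eq_left le_top] at this
  exact le_of_tendsto' ((ENNReal.continuous_rpow_const.tendsto _).comp hlim)
    fun N => hC A hA u hu N (ENNReal.natCast_ne_top N)

/-! ### Interpolation and weak compactness. -/

/-- Interpolation (Lyapunov's inequality) between Lebesgue norms. -/
theorem exists_eLpNorm_le_rpow_mul_rpow {p₀ q p₁ : ℝ} (h₀ : 0 < p₀) (h₀₁ : p₀ < p₁) (hq₀ : p₀ ≤ q)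
    (hq₁ : q ≤ p₁) :
    ∃ α : ℝ, 0 ≤ α ∧ α ≤ 1 ∧ (q < p₁ → 0 < α) ∧
      ∀ {X E : Type} [MeasurableSpace X] [NormedAddCommGroup E] (μ : Measure X) (f : X → E),
        AEStronglyMeasurable f μ →
        eLpNorm f (ENNReal.ofReal q) μ ≤ eLpNorm f (ENNReal.ofReal p₀) μ ^ α *
          eLpNorm f (ENNReal.ofReal p₁) μ ^ (1 - α) := by
  have hq : 0 < q := by linarith
  have h₁ : 0 < p₁ := by linarith
  have hd : 0 < p₁ - p₀ := by linarith
  -- `θ` writes `q` as a convex combination of the exponents; passing from integrals to norms turns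
  -- it into `α = θ p₀ / q`.
  set θ := (p₁ - q) / (p₁ - p₀) with hθ
  have hθ0 : 0 ≤ θ := div_nonneg (by linarith) hd.le
  have hθ1 : θ ≤ 1 := by rw [hθ, div_le_one hd]; linarith
  have hθq : θ * p₀ + (1 - θ) * p₁ = q := by rw [hθ]; field_simp; ring
  refine ⟨θ * p₀ / q, by positivity, ?_, fun h => ?_, fun {X E} _ _ μ f hf => ?_⟩
  · rw [div_le_one hq, ← hθq]
    have : 0 ≤ (1 - θ) * p₁ := mul_nonneg (by linarith) h₁.le
    linarith
  · have : 0 < θ := div_pos (by linarith) hd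
    positivity
  · have h1 : 1 - θ * p₀ / q = (1 - θ) * p₁ / q := by
      rw [eq_div_iff hq.ne', sub_mul, div_mul_cancel₀ _ hq.ne']; linarith
    have hlp : ∀ t : ℝ, 0 < t → eLpNorm f (ENNReal.ofReal t) μ =
        (∫⁻ x, ‖f x‖ₑ ^ t ∂μ) ^ (1 / t) := fun t ht => by
      rw [eLpNorm_eq_lintegral_rpow_enorm_toReal (by simpa using ht) ENNReal.ofReal_ne_top,
        ENNReal.toReal_ofReal ht.le]
    rw [hlp q hq, hlp p₀ h₀, hlp p₁ h₁, h1, ← ENNReal.rpow_mul, ← ENNReal.rpow_mul,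
      show 1 / p₀ * (θ * p₀ / q) = θ * (1 / q) by field_simp,
      show 1 / p₁ * ((1 - θ) * p₁ / q) = (1 - θ) * (1 / q) by field_simp, ENNReal.rpow_mul,
      ENNReal.rpow_mul, ← ENNReal.mul_rpow_of_nonneg _ _ (by positivity)]
    gcongr
    have h2 := ENNReal.lintegral_mul_norm_pow_le (hf.enorm.pow_const p₀) (hf.enorm.pow_const p₁)
      hθ0 (by linarith) (by ring : θ + (1 - θ) = 1)
    refine le_trans (le_of_eq (lintegral_congr fun x => ?_)) h2
    rw [← ENNReal.rpow_mul, ← ENNReal.rpow_mul, ← ENNReal.rpow_add_of_nonneg _ _ (by positivity)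
      (mul_nonneg h₁.le (by linarith)), ← hθq]
    congr 1; ring

/-- Sequential Banach–Alaoglu in the dual, carried back by the Riesz isomorphism. -/
theorem exists_subseq_weak_tendsto {H : Type*} [NormedAddCommGroup H] [InnerProductSpace ℂ H]
    [CompleteSpace H] [TopologicalSpace.SeparableSpace H] {x : ℕ → H} {M : ℝ}
    (hx : ∀ n, ‖x n‖ ≤ M) :
    ∃ (v : H) (g : ℕ → ℕ), StrictMono g ∧
      ∀ φ : H, Tendsto (fun n => inner ℂ φ (x (g n))) atTop (𝓝 (inner ℂ φ v)) := by
  obtain ⟨a, -, g, hg, ha⟩ := WeakDual.isSeqCompact_closedBall ℂ H 0 M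
    (x := fun n => StrongDual.toWeakDual (InnerProductSpace.toDual ℂ H (x n)))
    (fun n => by simpa using hx n)
  refine ⟨(InnerProductSpace.toDual ℂ H).symm (WeakDual.toStrongDual a), g, hg, fun φ => ?_⟩
  have h1 : Tendsto (fun n => inner ℂ (x (g n)) φ) atTop (𝓝 (a φ)) :=
    ((WeakDual.eval_continuous φ).tendsto a).comp ha
  have h2 := (Complex.continuous_conj.tendsto _).comp h1
  rw [← inner_conj_symm, InnerProductSpace.toDual_symm_apply]
  exact h2.congr fun n => inner_conj_symm _ _

/-- Testing against the adjoint of `T` identifies the strong limit with `T v`. -/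
theorem tendsto_map_of_weak_tendsto_of_cauchySeq {H H' : Type*} [NormedAddCommGroup H]
    [InnerProductSpace ℂ H] [CompleteSpace H] [NormedAddCommGroup H'] [InnerProductSpace ℂ H']
    [CompleteSpace H'] (T : H →L[ℂ] H') {x : ℕ → H} {v : H}
    (hx : ∀ φ : H, Tendsto (fun n => inner ℂ φ (x n)) atTop (𝓝 (inner ℂ φ v)))
    (hT : CauchySeq fun n => T (x n)) : Tendsto (fun n => T (x n)) atTop (𝓝 (T v)) := by
  obtain ⟨w, hw⟩ := cauchySeq_tendsto_of_complete hT
  have : w = T v := ext_inner_left ℂ fun φ => by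
    have h1 : Tendsto (fun n => inner ℂ φ (T (x n))) atTop (𝓝 (inner ℂ φ w)) :=
      tendsto_const_nhds.inner hw
    have h2 := hx (ContinuousLinearMap.adjoint T φ)
    simp_rw [ContinuousLinearMap.adjoint_inner_left] at h2
    exact tendsto_nhds_unique h1 h2
  rwa [← this]

/-! ### Ball averages and local compactness in `L²`. -/

theorem aestronglyMeasurable_setAverage_ball {u : E3 → ℂ} (hu : AEStronglyMeasurable u volume)
    (r : ℝ) :
    AEStronglyMeasurable (fun x => ⨍ y in Metric.ball x r, u y) (volume : Measure E3) := by
  simp_rw [setAverage_eq, Measure.real, Measure.addHaar_ball_center]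
  refine AEStronglyMeasurable.const_smul ?_ _
  have h : AEStronglyMeasurable ({p : E3 × E3 | dist p.2 p.1 < r}.indicator fun p => u p.2)
      ((volume : Measure E3).prod volume) :=
    hu.comp_snd.indicator (isOpen_lt (by fun_prop) continuous_const).measurableSet
  refine h.integral_prod_right'.congr (Eventually.of_forall fun x => ?_)
  dsimp only
  rw [← integral_indicator measurableSet_ball]
  rfl

theorem enorm_setAverage_le_lintegral {u : E3 → ℂ} (x : E3) (r : ℝ) :
    ‖⨍ y in Metric.ball x r, u y‖ₑ ≤
      (volume (Metric.ball x r))⁻¹ * ∫⁻ y in Metric.ball x r, ‖u y‖ₑ := by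
  refine (enorm_integral_le_lintegral_enorm _).trans (le_of_eq ?_)
  rw [lintegral_smul_measure, Measure.restrict_apply_univ, smul_eq_mul]

/-- The bound does not depend on `x`, so at fixed `r` it is a dominating constant on compact sets.
-/
theorem enorm_setAverage_le {u : E3 → ℂ} (hu : AEStronglyMeasurable u volume) (x : E3) {r : ℝ}
    (hr : 0 < r) :
    ‖⨍ y in Metric.ball x r, u y‖ₑ ≤
      ENNReal.ofReal (volume.real (Metric.ball (0 : E3) 1) ^ (-(1 / 2) : ℝ)) *
        ENNReal.ofReal (r ^ (-(3 / 2) : ℝ)) * eLpNorm u 2 volume := by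
  refine (enorm_setAverage_le_lintegral x r).trans ?_
  have h := lintegral_le_rpow_mul_measure_univ hu.enorm.restrict one_le_two
    (μ := volume.restrict (Metric.ball x r))
  refine (mul_le_mul_right h _).trans ?_
  rw [Measure.restrict_apply_univ, mul_left_comm, inv_volume_ball_mul_rpow hr, mul_comm,
    eLpNorm_eq_lintegral_rpow_enorm_toReal two_ne_zero ENNReal.ofNat_ne_top]
  norm_num only [ENNReal.toReal_ofNat]
  gcongr
  exact Measure.restrict_le_self

theorem integrableOn_ball_of_memLp_two {u : E3 → ℂ} (hu : MemLp u 2 volume) (x : E3) (r : ℝ) :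
    IntegrableOn u (Metric.ball x r) volume := by
  have : IsFiniteMeasure (volume.restrict (Metric.ball x r)) := ⟨by
    rw [Measure.restrict_apply_univ]; exact measure_ball_lt_top⟩
  exact (hu.restrict _).integrable one_le_two

/-- Oscillation estimate: `u` is close to its averages over small balls, locally uniformly in terms
of the local energy. -/
theorem enorm_sub_setAverage_le {s : ℝ} (hs0 : 0 < s) (hs1 : s < 1) {A : E3 → E3}
    (hA : Continuous A) {a R : ℝ} (ha0 : 0 ≤ a)
    (ha : ∀ z ∈ Metric.closedBall (0 : E3) (R + 1), ‖A z‖ ≤ a) {u : E3 → ℂ}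
    (hu : MemLp u 2 volume) {x : E3} (hx : x ∈ Metric.closedBall (0 : E3) R) {r : ℝ} (hr0 : 0 < r)
    (hr1 : r ≤ 1) :
    ‖u x - ⨍ y in Metric.ball x r, u y‖ₑ ≤
      ENNReal.ofReal ((volume.real (Metric.ball (0 : E3) 1) ^ (-(1 / 2) : ℝ) + a) * r ^ s) *
        localEnergy s A u x ^ (1 / 2 : ℝ) := by
  have hB := volume_ball_ne_zero hr0 x
  have hB' : volume (Metric.ball x r) ≠ ⊤ := measure_ball_lt_top.ne
  have hosc : ∀ y ∈ Metric.ball x r,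
      ‖u x - u y‖ₑ ≤ ‖magDiff A u x y‖ₑ + ENNReal.ofReal (r * a) * ‖u x‖ₑ := by
    intro y hy
    rw [Metric.mem_ball, dist_comm, dist_eq_norm] at hy
    set θ : ℝ := inner ℝ (x - y) (A ((1 / 2 : ℝ) • (x + y))) with hθ
    have hmid : ‖A ((1 / 2 : ℝ) • (x + y))‖ ≤ a := by
      refine ha _ ?_
      rw [mem_closedBall_zero_iff] at hx ⊢
      have e : (1 / 2 : ℝ) • (x + y) = x - (1 / 2 : ℝ) • (x - y) := by module
      rw [e]
      refine (norm_sub_le _ _).trans ?_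
      rw [norm_smul, Real.norm_of_nonneg (by norm_num)]
      linarith [norm_nonneg (x - y)]
    have hθr : ‖-θ‖ ≤ r * a := by
      rw [norm_neg]
      exact (norm_inner_le_norm _ _).trans (by gcongr)
    -- Removing the phase costs `|e^(-iθ) - 1| ≤ |θ| ≤ r a`; the midpoint stays in the ball of
    -- radius `R + 1`, where `a` bounds `A`.
    have e : u x - u y = magDiff A u x y - (Complex.exp (Complex.I * ((-θ : ℝ) : ℂ)) - 1) * u x := by
      rw [magDiff, ← hθ, Complex.ofReal_neg, mul_neg, neg_mul]; ring
    rw [e]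
    refine enorm_sub_le.trans ?_
    gcongr
    rw [enorm_mul]
    gcongr
    rw [← ofReal_norm]
    exact ENNReal.ofReal_le_ofReal (Real.norm_exp_I_mul_ofReal_sub_one_le.trans hθr)
  have havg : u x - ⨍ y in Metric.ball x r, u y = ⨍ y in Metric.ball x r, (u x - u y) := by
    rw [setAverage_eq, setAverage_eq, integral_sub (integrableOn_const hB' : IntegrableOn (fun _ => u x) _ volume)
      (integrableOn_ball_of_memLp_two hu x r), setIntegral_const, smul_sub, smul_smul,
      inv_mul_cancel₀ (a := volume.real (Metric.ball x r)) (ENNReal.toReal_pos hB hB').ne', one_smul]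
  have hV : ‖u x‖ₑ ≤ localEnergy s A u x ^ (1 / 2 : ℝ) := by
    rw [one_div, ENNReal.le_rpow_inv_iff two_pos, ENNReal.rpow_two]
    exact enorm_sq_le_localEnergy s A u x
  rw [havg]
  refine (enorm_setAverage_le_lintegral x r).trans ?_
  have h1 : ∫⁻ y in Metric.ball x r, ‖u x - u y‖ₑ ≤
      (∫⁻ y in Metric.ball x r, ‖magDiff A u x y‖ₑ) +
        ENNReal.ofReal (r * a) * ‖u x‖ₑ * volume (Metric.ball x r) := by
    rw [← setLIntegral_const, ← lintegral_add_right _ measurable_const]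
    exact setLIntegral_mono' measurableSet_ball hosc
  refine (mul_le_mul_right h1 _).trans ?_
  rw [mul_add, mul_left_comm, ENNReal.inv_mul_cancel hB hB', mul_one, add_mul,
    ENNReal.ofReal_add (by positivity) (by positivity), add_mul]
  refine add_le_add ?_ ?_
  · rw [ENNReal.ofReal_mul (by positivity), mul_assoc]
    exact inv_volume_ball_mul_lintegral_magDiff_le hs0 hA hu.1 x hr0 hr1
  · have : r ≤ r ^ s := by
      simpa using Real.rpow_le_rpow_of_exponent_ge hr0 hr1 hs1.le
    rw [mul_comm r]
    gcongr

theorem tendsto_eLpNorm_setAverage_sub {u : ℕ → E3 → ℂ} {v : E3 → ℂ}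
    (hu : ∀ n, AEStronglyMeasurable (u n) volume) (hv : MemLp v 2 volume) {M : ℝ≥0∞} (hM : M ≠ ⊤)
    (huM : ∀ n, eLpNorm (u n) 2 volume ≤ M) {r : ℝ} (hr : 0 < r)
    (hlim : ∀ x : E3, Tendsto (fun n => ∫ y in Metric.ball x r, u n y) atTop
      (𝓝 (∫ y in Metric.ball x r, v y))) {K : Set E3} (hK : IsCompact K) :
    Tendsto (fun n => eLpNorm (fun x => (⨍ y in Metric.ball x r, u n y) -
      ⨍ y in Metric.ball x r, v y) 2 (volume.restrict K)) atTop (𝓝 0) := by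
  set c := ENNReal.ofReal (volume.real (Metric.ball (0 : E3) 1) ^ (-(1 / 2) : ℝ)) *
        ENNReal.ofReal (r ^ (-(3 / 2) : ℝ)) with hc_def
  have hc : c ≠ ⊤ := ENNReal.mul_ne_top ENNReal.ofReal_ne_top ENNReal.ofReal_ne_top
  simp_rw [eLpNorm_eq_lintegral_rpow_enorm_toReal two_ne_zero ENNReal.ofNat_ne_top,
    ENNReal.toReal_ofNat]
  have hpt : ∀ x, Tendsto (fun n => (⨍ y in Metric.ball x r, u n y) -
      ⨍ y in Metric.ball x r, v y) atTop (𝓝 0) := fun x => by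
    rw [← sub_self (⨍ y in Metric.ball x r, v y)]
    simp_rw [setAverage_eq]
    exact ((hlim x).const_smul _).sub_const _
  have h0 : Tendsto (fun n => ∫⁻ x in K, ‖(⨍ y in Metric.ball x r, u n y) -
      ⨍ y in Metric.ball x r, v y‖ₑ ^ (2 : ℝ)) atTop (𝓝 (∫⁻ x in K, 0)) := by
    refine tendsto_lintegral_of_dominated_convergence' (fun _ => (c * M + c * eLpNorm v 2 volume) ^
      (2 : ℝ)) (fun n => ?_) (fun n => Eventually.of_forall fun x => ?_) ?_
      (Eventually.of_forall fun x => ?_)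
    · exact (((aestronglyMeasurable_setAverage_ball (hu n) r).sub
        (aestronglyMeasurable_setAverage_ball hv.1 r)).enorm.pow_const _).restrict
    · dsimp only
      gcongr
      refine enorm_sub_le.trans (add_le_add ?_ (enorm_setAverage_le hv.1 x hr))
      exact (enorm_setAverage_le (hu n) x hr).trans (by gcongr; exact huM n)
    · rw [lintegral_const, Measure.restrict_apply_univ]
      refine ENNReal.mul_ne_top (ENNReal.rpow_ne_top_of_nonneg (by norm_num) ?_) hK.measure_ne_top
      exact ENNReal.add_ne_top.2 ⟨ENNReal.mul_ne_top hc hM, ENNReal.mul_ne_top hc hv.2.ne⟩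
    · have h1 := (continuous_enorm.tendsto _).comp (hpt x)
      have h2 := (ENNReal.continuous_rpow_const (y := 2).tendsto _).comp h1
      simpa [Function.comp_def] using h2
  rw [lintegral_zero] at h0
  have h3 := (ENNReal.continuous_rpow_const (y := 1 / 2).tendsto _).comp h0
  simpa [Function.comp_def] using h3

theorem eLpNorm_two_le_lintegral_localEnergy (s : ℝ) (A : E3 → E3) (u : E3 → ℂ) :
    eLpNorm u 2 volume ≤ (∫⁻ x, localEnergy s A u x) ^ (1 / 2 : ℝ) := by
  rw [eLpNorm_eq_lintegral_rpow_enorm_toReal two_ne_zero ENNReal.ofNat_ne_top, ENNReal.toReal_ofNat]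
  gcongr with x
  rw [ENNReal.rpow_two]
  exact enorm_sq_le_localEnergy s A u x

theorem eLpNorm_sub_setAverage_le {s : ℝ} (hs0 : 0 < s) (hs1 : s < 1) {A : E3 → E3}
    (hA : Continuous A) {K : Set E3} (hK : IsCompact K) :
    ∃ C : ℝ, 0 ≤ C ∧ ∀ (u : E3 → ℂ) (_ : MemLp u 2 volume) (r : ℝ), 0 < r → r ≤ 1 →
      eLpNorm (fun x => u x - ⨍ y in Metric.ball x r, u y) 2 (volume.restrict K) ≤
        ENNReal.ofReal (C * r ^ s) * (∫⁻ x, localEnergy s A u x) ^ (1 / 2 : ℝ) := by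
  obtain ⟨R, hR⟩ := hK.isBounded.subset_closedBall (0 : E3)
  obtain ⟨a, ha⟩ := (isCompact_closedBall (0 : E3) (R + 1)).exists_bound_of_continuousOn
    hA.continuousOn
  have ha' : ∀ z ∈ Metric.closedBall (0 : E3) (R + 1), ‖A z‖ ≤ max a 0 :=
    fun z hz => (ha z hz).trans (le_max_left _ _)
  refine ⟨volume.real (Metric.ball (0 : E3) 1) ^ (-(1 / 2) : ℝ) + max a 0, by positivity,
    fun u hu r hr0 hr1 => ?_⟩
  set C := volume.real (Metric.ball (0 : E3) 1) ^ (-(1 / 2) : ℝ) + max a 0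
  rw [eLpNorm_eq_lintegral_rpow_enorm_toReal two_ne_zero ENNReal.ofNat_ne_top, ENNReal.toReal_ofNat,
    one_div, ENNReal.rpow_inv_le_iff two_pos, ENNReal.mul_rpow_of_nonneg _ _ zero_le_two,
    ← ENNReal.rpow_mul, inv_mul_cancel₀ two_ne_zero, ENNReal.rpow_one,
    ← lintegral_const_mul' _ _ (ENNReal.rpow_ne_top_of_nonneg zero_le_two ENNReal.ofReal_ne_top)]
  refine (setLIntegral_mono_ae' hK.measurableSet (Eventually.of_forall fun x hx => ?_)).trans
    (lintegral_mono' Measure.restrict_le_self le_rfl)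
  have h := enorm_sub_setAverage_le hs0 hs1 hA (le_max_right a 0) ha' hu (hR hx) hr0 hr1
  refine (ENNReal.rpow_le_rpow h zero_le_two).trans (le_of_eq ?_)
  rw [ENNReal.mul_rpow_of_nonneg _ _ zero_le_two, ← ENNReal.rpow_mul,
    one_div_mul_cancel two_ne_zero, ENNReal.rpow_one]

/-- Local compactness in `L²`. -/
theorem exists_subseq_tendsto_eLpNorm_two {s : ℝ} (hs0 : 0 < s) (hs1 : s < 1) {A : E3 → E3}
    (hA : Continuous A) {u : ℕ → E3 → ℂ} (hu : ∀ n, AEStronglyMeasurable (u n) volume) {M : ℝ≥0∞}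
    (hM : M ≠ ⊤) (huM : ∀ n, (∫⁻ x, localEnergy s A (u n) x) ^ (1 / 2 : ℝ) ≤ M) :
    ∃ (v : E3 → ℂ) (g : ℕ → ℕ), StrictMono g ∧ MemLp v 2 volume ∧ ∀ K : Set E3, IsCompact K →
      Tendsto (fun n => eLpNorm (u (g n) - v) 2 (volume.restrict K)) atTop (𝓝 0) := by
  have huM2 : ∀ n, eLpNorm (u n) 2 volume ≤ M :=
    fun n => (eLpNorm_two_le_lintegral_localEnergy s A (u n)).trans (huM n)
  have hu2 : ∀ n, MemLp (u n) 2 volume := fun n => ⟨hu n, (huM2 n).trans_lt hM.lt_top⟩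
  have : Fact ((2 : ℝ≥0∞) ≠ ⊤) := ⟨ENNReal.ofNat_ne_top⟩
  -- The weak limit is taken on the whole space before `K` is fixed, so one subsequence serves all
  -- compact sets without a diagonal argument.
  obtain ⟨v, g, hg, hweak⟩ := exists_subseq_weak_tendsto (x := fun n => (hu2 n).toLp)
    (M := M.toReal) fun n => by
      rw [Lp.norm_toLp]; exact ENNReal.toReal_mono hM (huM2 n)
  have hv := Lp.memLp v
  refine ⟨v, g, hg, hv, fun K hK => ?_⟩
  have hball : ∀ (x : E3) (r : ℝ), Tendsto (fun n => ∫ y in Metric.ball x r, u (g n) y) atTop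
      (𝓝 (∫ y in Metric.ball x r, v y)) := fun x r => by
    have h := hweak (indicatorConstLp 2 measurableSet_ball
      (measure_ball_lt_top (μ := volume) (x := x) (r := r)).ne (1 : ℂ))
    simp_rw [L2.inner_indicatorConstLp_one] at h
    refine h.congr fun n => setIntegral_congr_ae measurableSet_ball ?_
    filter_upwards [(hu2 (g n)).coeFn_toLp] with y hy _ using hy
  set T := LpToLpRestrictCLM E3 ℂ ℂ volume 2 K
  have hTu : ∀ n, T ((hu2 n).toLp) = ((hu2 n).restrict K).toLp := fun n => by
    refine Lp.ext ?_
    filter_upwards [LpToLpRestrictCLM_coeFn ℂ K ((hu2 n).toLp),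
      ((hu2 n).restrict K).coeFn_toLp, ae_restrict_of_ae (hu2 n).coeFn_toLp] with x h1 h2 h3
    rw [h1, h2, h3]
  have hcauchy : CauchySeq fun n => T ((hu2 (g n)).toLp) := by
    rw [EMetric.cauchySeq_iff]
    intro ε hε
    obtain ⟨C, hC0, hC⟩ := eLpNorm_sub_setAverage_le hs0 hs1 hA hK
    -- Each of two terms of the sequence lies within `2ε/5` of the averages of `v`, so their
    -- distance is at most `4ε/5`, strictly below `ε` when `ε` is finite.
    have hε5 : 0 < ε / 5 := ENNReal.div_pos hε.ne' (by norm_num)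
    obtain ⟨r, hr0, hr1, hr⟩ : ∃ r : ℝ, 0 < r ∧ r ≤ 1 ∧ ENNReal.ofReal (C * r ^ s) * M < ε / 5 := by
      have h1 : Tendsto (fun r : ℝ => ENNReal.ofReal (C * r ^ s) * M) (𝓝[>] 0) (𝓝 0) := by
        have h2 : Tendsto (fun r : ℝ => C * r ^ s) (𝓝[>] 0) (𝓝 0) := by
          have h3 := ((Real.continuousAt_rpow_const 0 s (Or.inr hs0.le)).tendsto.const_mul C).mono_left
            (nhdsWithin_le_nhds (s := Set.Ioi 0))
          simpa [Real.zero_rpow hs0.ne'] using h3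
        have h4 := ENNReal.Tendsto.mul_const (ENNReal.tendsto_ofReal h2) (Or.inr hM)
        simpa using h4
      obtain ⟨r, h5, h6⟩ := ((h1.eventually_lt_const hε5).and
        (Ioc_mem_nhdsGT (one_pos : (0 : ℝ) < 1))).exists
      exact ⟨r, h6.1, h6.2, h5⟩
    have hosc : ∀ n, eLpNorm (fun x => u (g n) x - ⨍ y in Metric.ball x r, u (g n) y) 2
        (volume.restrict K) ≤ ε / 5 := fun n => (hC _ (hu2 _) r hr0 hr1).trans
          ((mul_le_mul_right (huM _) _).trans hr.le)
    have havg := tendsto_eLpNorm_setAverage_sub (fun n => hu (g n)) hv hM (fun n => huM2 (g n)) hr0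
      (fun x => hball x r) hK
    obtain ⟨N, hN⟩ := eventually_atTop.1 (havg.eventually_lt_const hε5)
    have hP : ∀ n, AEStronglyMeasurable (fun x => ⨍ y in Metric.ball x r, u n y)
      (volume.restrict K) := fun n => (aestronglyMeasurable_setAverage_ball (hu n) r).restrict
    have hPv := (aestronglyMeasurable_setAverage_ball hv.1 r).restrict (s := K)
    have hhalf : ∀ n ≥ N, eLpNorm (fun x => u (g n) x - ⨍ y in Metric.ball x r, v y) 2
        (volume.restrict K) ≤ ε / 5 + ε / 5 := fun n hn => by
      have e : (fun x => u (g n) x - ⨍ y in Metric.ball x r, v y) =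
          (fun x => u (g n) x - ⨍ y in Metric.ball x r, u (g n) y) +
          fun x => (⨍ y in Metric.ball x r, u (g n) y) - ⨍ y in Metric.ball x r, v y := by
        ext x; simp
      rw [e]
      exact (eLpNorm_add_le ((hu _).restrict.sub (hP _)) ((hP _).sub hPv) one_le_two).trans
        (add_le_add (hosc n) (hN n hn).le)
    refine ⟨N, fun n hn k hk => ?_⟩
    rw [hTu, hTu, Lp.edist_toLp_toLp]
    have e : u (g n) - u (g k) = (fun x => u (g n) x - ⨍ y in Metric.ball x r, v y) -
        fun x => u (g k) x - ⨍ y in Metric.ball x r, v y := by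
      ext x; simp
    rw [e]
    rcases eq_or_ne ε ⊤ with hεt | hεt
    · rw [hεt, ← e]
      exact (((hu2 (g n)).sub (hu2 (g k))).restrict K).2
    refine (eLpNorm_sub_le ((hu _).restrict.sub hPv) ((hu _).restrict.sub hPv) one_le_two).trans_lt ?_
    refine (add_le_add (hhalf n hn) (hhalf k hk)).trans_lt ?_
    lift ε to ℝ≥0 using hεt
    have hε' : 0 < (ε : ℝ) := by exact_mod_cast hε
    rw [show ((ε : ℝ≥0∞) / 5) = ((ε / 5 : ℝ≥0) : ℝ≥0∞) by simp]
    norm_cast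
    rw [← NNReal.coe_lt_coe]
    push_cast
    linarith
  have hstrong := tendsto_map_of_weak_tendsto_of_cauchySeq T hweak hcauchy
  rw [Lp.tendsto_Lp_iff_tendsto_eLpNorm'] at hstrong
  refine hstrong.congr fun n => eLpNorm_congr_ae ?_
  filter_upwards [LpToLpRestrictCLM_coeFn ℂ K v, LpToLpRestrictCLM_coeFn ℂ K ((hu2 (g n)).toLp),
    ae_restrict_of_ae (hu2 (g n)).coeFn_toLp] with x h1 h2 h3
  simp only [Pi.sub_apply]
  rw [h1, h2, h3]

/-! ### The two embeddings. -/

theorem exists_localEnergy_rpow_le_magNorm {s m : ℝ} (hs0 : 0 < s) (hs1 : s < 1) (hm : 0 < m)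
    {A : E3 → E3} (hA : Continuous A) :
    ∃ C : ℝ≥0, ∀ u : E3 → ℂ, AEStronglyMeasurable u volume →
      (∫⁻ x, localEnergy s A u x) ^ (1 / 2 : ℝ) ≤ C * magNorm s m A u := by
  obtain ⟨C, hC⟩ := exists_lintegral_localEnergy_le hs0 hs1 hm hA
  refine ⟨C ^ (1 / 2 : ℝ), fun u hu => ?_⟩
  rw [ENNReal.coe_rpow_of_nonneg _ (by norm_num), magNorm,
    ← ENNReal.mul_rpow_of_nonneg _ _ (by norm_num)]
  exact ENNReal.rpow_le_rpow (hC u hu) (by norm_num)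

theorem embedsContinuously {s m : ℝ} (hs0 : 0 < s) (hs1 : s < 1) (hm : 0 < m) {A : E3 → E3}
    (hA : Continuous A) {q : ℝ} (hq : 2 ≤ q) (hq' : q ≤ critExp s) :
    EmbedsContinuously s m A q := by
  obtain ⟨C, hC⟩ := exists_localEnergy_rpow_le_magNorm hs0 hs1 hm hA
  obtain ⟨C', hC'⟩ := exists_eLpNorm_critExp_le hs0 hs1
  obtain ⟨α, hα0, hα1, -, hα⟩ :=
    exists_eLpNorm_le_rpow_mul_rpow two_pos (two_lt_critExp hs0 hs1) hq hq'
  have key : ∀ u : E3 → ℂ, AEStronglyMeasurable u volume →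
      eLpNorm u (ENNReal.ofReal q) volume ≤ ((1 + C') * C : ℝ≥0) * magNorm s m A u := by
    intro u hu
    set E := (∫⁻ x, localEnergy s A u x) ^ (1 / 2 : ℝ) with hE
    have h2 : eLpNorm u (ENNReal.ofReal 2) volume ≤ (1 + C') * E := by
      rw [ENNReal.ofReal_ofNat]
      exact (eLpNorm_two_le_lintegral_localEnergy s A u).trans
        (le_mul_of_one_le_left zero_le le_self_add)
    have hp : eLpNorm u (ENNReal.ofReal (critExp s)) volume ≤ (1 + C') * E :=
      (hC' A hA u hu).trans (by gcongr; exact le_add_self)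
    calc eLpNorm u (ENNReal.ofReal q) volume
        ≤ ((1 + C') * E) ^ α * ((1 + C') * E) ^ (1 - α) :=
          (hα volume u hu).trans (mul_le_mul' (ENNReal.rpow_le_rpow h2 hα0)
            (ENNReal.rpow_le_rpow hp (by linarith)))
      _ = (1 + C') * E := by
          rw [← ENNReal.rpow_add_of_nonneg _ _ hα0 (by linarith), add_sub_cancel, ENNReal.rpow_one]
      _ ≤ _ := by
          rw [ENNReal.coe_mul, mul_assoc, ENNReal.coe_add, ENNReal.coe_one]
          gcongr
          exact hC u hu
  refine ⟨(1 + C') * C, fun u hu => ⟨⟨hu.1.1, (key u hu.1.1).trans_lt ?_⟩, key u hu.1.1⟩⟩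
  exact ENNReal.mul_lt_top ENNReal.coe_lt_top
    (ENNReal.rpow_lt_top_of_nonneg (by norm_num) hu.1.2.ne)

theorem eLpNorm_restrict_le_of_le {K : Set E3} (hK : IsCompact K) {q q' : ℝ} (hq : 0 < q)
    (hqq' : q ≤ q') : ∃ C : ℝ≥0, ∀ u : E3 → ℂ, AEStronglyMeasurable u (volume.restrict K) →
      eLpNorm u (ENNReal.ofReal q) (volume.restrict K) ≤
        C * eLpNorm u (ENNReal.ofReal q') (volume.restrict K) := by
  have h : volume K ^ (1 / q - 1 / q') ≠ ⊤ := ENNReal.rpow_ne_top_of_nonneg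
    (sub_nonneg.2 (one_div_le_one_div_of_le hq hqq')) hK.measure_ne_top
  refine ⟨(volume K ^ (1 / q - 1 / q')).toNNReal, fun u hu => ?_⟩
  have := eLpNorm_le_eLpNorm_mul_rpow_measure_univ (ENNReal.ofReal_le_ofReal hqq') hu
  rwa [Measure.restrict_apply_univ, ENNReal.toReal_ofReal hq.le,
    ENNReal.toReal_ofReal (hq.le.trans hqq'), mul_comm, ← ENNReal.coe_toNNReal h] at this

/-- Local `L²` convergence and a critical bound give local convergence in every subcritical
Lebesgue space. -/
theorem memLqLoc_and_tendstoLqLoc {s : ℝ} (hs0 : 0 < s) (hs1 : s < 1) {q : ℝ} (hq1 : 1 ≤ q)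
    (hq : q < critExp s) {u : ℕ → E3 → ℂ} {v : E3 → ℂ}
    (hu : ∀ n, AEStronglyMeasurable (u n) volume) (hv : AEStronglyMeasurable v volume) {M : ℝ≥0}
    (hM : ∀ n, eLpNorm (u n) (ENNReal.ofReal (critExp s)) volume ≤ M)
    (h2 : ∀ K : Set E3, IsCompact K →
      Tendsto (fun n => eLpNorm (u n - v) 2 (volume.restrict K)) atTop (𝓝 0)) :
    MemLqLoc q v ∧ TendstoLqLoc q u v := by
  have hp := two_lt_critExp hs0 hs1
  -- Fatou along an almost everywhere convergent subsequence passes the critical bound to the limit.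
  have hvp : ∀ K : Set E3, IsCompact K →
      eLpNorm v (ENNReal.ofReal (critExp s)) (volume.restrict K) ≤ M := fun K hK => by
    obtain ⟨g, -, hg⟩ := (tendstoInMeasure_of_tendsto_eLpNorm two_ne_zero
      (fun n => (hu n).restrict) hv.restrict (h2 K hK)).exists_seq_tendsto_ae
    refine (Lp.eLpNorm_lim_le_liminf_eLpNorm (fun n => (hu (g n)).restrict) v hg).trans ?_
    exact liminf_le_of_le (by isBoundedDefault) fun b hb => by
      obtain ⟨n, hn⟩ := hb.exists
      exact hn.trans ((eLpNorm_mono_measure _ Measure.restrict_le_self).trans (hM _))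
  refine ⟨fun K hK => ?_, fun K hK => ?_⟩
  · obtain ⟨C, hC⟩ := eLpNorm_restrict_le_of_le hK (by linarith) hq.le
    exact ⟨hv.restrict, (hC v hv.restrict).trans_lt
      (ENNReal.mul_lt_top ENNReal.coe_lt_top ((hvp K hK).trans_lt ENNReal.coe_lt_top))⟩
  -- Interpolation from `L²` needs an exponent at least 2, hence `max q 2`; Hölder on `K` comes back
  -- down to `q`. The strict inequality `max q 2 < critExp s` gives `L²` convergence a positive
  -- power `α`.
  · obtain ⟨C, hC⟩ := eLpNorm_restrict_le_of_le hK (by linarith) (le_max_left q 2)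
    obtain ⟨α, -, hα1, hαpos, hα⟩ := exists_eLpNorm_le_rpow_mul_rpow two_pos hp
      (le_max_right q 2) (max_le hq.le hp.le)
    have hαpos := hαpos (max_lt hq hp)
    have hmeas : ∀ n, AEStronglyMeasurable (u n - v) (volume.restrict K) :=
      fun n => ((hu n).sub hv).restrict
    have hdiff : ∀ n, eLpNorm (u n - v) (ENNReal.ofReal (critExp s)) (volume.restrict K) ≤ M + M :=
      fun n => (eLpNorm_sub_le (hu n).restrict hv.restrict (by
          rw [ENNReal.one_le_ofReal]; linarith)).trans
        (add_le_add ((eLpNorm_mono_measure _ Measure.restrict_le_self).trans (hM n)) (hvp K hK))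
    refine tendsto_of_tendsto_of_tendsto_of_le_of_le tendsto_const_nhds
      (h := fun n => C * (eLpNorm (u n - v) 2 (volume.restrict K) ^ α *
        ((M + M : ℝ≥0) : ℝ≥0∞) ^ (1 - α))) ?_
      (fun n => zero_le) fun n => ?_
    · have h3 : Tendsto (fun n => eLpNorm (u n - v) 2 (volume.restrict K) ^ α) atTop (𝓝 0) := by
        have := (ENNReal.continuous_rpow_const (y := α).tendsto _).comp (h2 K hK)
        simpa [Function.comp_def, ENNReal.zero_rpow_of_pos hαpos] using this
      have h4 := ENNReal.Tendsto.mul_const (b := ((M + M : ℝ≥0) : ℝ≥0∞) ^ (1 - α)) h3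
        (Or.inr (ENNReal.rpow_ne_top_of_nonneg (by linarith) ENNReal.coe_ne_top))
      have h5 := ENNReal.Tendsto.const_mul (a := (C : ℝ≥0∞)) h4 (Or.inr ENNReal.coe_ne_top)
      simpa using h5
    · refine (hC _ (hmeas n)).trans ?_
      dsimp only
      gcongr
      refine (hα _ _ (hmeas n)).trans ?_
      rw [ENNReal.ofReal_ofNat]
      gcongr
      rw [ENNReal.coe_add]
      exact hdiff n

theorem embedsCompactlyLoc {s m : ℝ} (hs0 : 0 < s) (hs1 : s < 1) (hm : 0 < m) {A : E3 → E3}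
    (hA : Continuous A) {q : ℝ} (hq : 1 ≤ q) (hq' : q < critExp s) :
    EmbedsCompactlyLoc s m A q := by
  have hp := two_lt_critExp hs0 hs1
  obtain ⟨C, hC⟩ := embedsContinuously hs0 hs1 hm hA hp.le le_rfl
  have hbound : ∀ K : Set E3, IsCompact K → ∃ C : ℝ≥0, ∀ u : E3 → ℂ, MemHsA s m A u →
      eLpNorm u (ENNReal.ofReal q) (volume.restrict K) ≤ C * magNorm s m A u := fun K hK => by
    obtain ⟨C', hC'⟩ := eLpNorm_restrict_le_of_le hK (by linarith) hq'.le
    refine ⟨C' * C, fun u hu => (hC' u hu.1.1.restrict).trans ?_⟩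
    rw [ENNReal.coe_mul, mul_assoc]
    gcongr
    exact (eLpNorm_mono_measure _ Measure.restrict_le_self).trans (hC u hu).2
  refine ⟨fun u hu K hK => ?_, hbound, fun u hu ⟨M, hM⟩ => ?_⟩
  · obtain ⟨C', hC'⟩ := hbound K hK
    exact ⟨hu.1.1.restrict, (hC' u hu).trans_lt (ENNReal.mul_lt_top ENNReal.coe_lt_top
      (ENNReal.rpow_lt_top_of_nonneg (by norm_num) hu.1.2.ne))⟩
  · obtain ⟨C', hC'⟩ := exists_localEnergy_rpow_le_magNorm hs0 hs1 hm hA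
    obtain ⟨v, g, hg, hv, hlim⟩ := exists_subseq_tendsto_eLpNorm_two hs0 hs1 hA
      (fun n => (hu n).1.1) (M := C' * M) (ENNReal.mul_ne_top ENNReal.coe_ne_top ENNReal.coe_ne_top)
      fun n => (hC' _ (hu n).1.1).trans (mul_le_mul_right (hM n) _)
    refine ⟨v, g, hg, memLqLoc_and_tendstoLqLoc hs0 hs1 hq hq' (fun n => (hu (g n)).1.1) hv.1
      (M := C * M) (fun n => (hC _ (hu (g n))).2.trans ?_) hlim⟩
    rw [ENNReal.coe_mul]
    exact mul_le_mul_right (hM _) _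

end MagneticSobolev

theorem mainTheorem10 (s m : ℝ) (hs0 : 0 < s) (hs1 : s < 1) (hm : 0 < m)
    (A : MagneticSobolev.E3 → MagneticSobolev.E3) (hA : LocallyLipschitz A) :
    (∀ q : ℝ, 2 ≤ q → q ≤ MagneticSobolev.critExp s →
      MagneticSobolev.EmbedsContinuously s m A q) ∧
    (∀ q : ℝ, 1 ≤ q → q < MagneticSobolev.critExp s →
      MagneticSobolev.EmbedsCompactlyLoc s m A q) :=
  ⟨fun _ hq hq' => MagneticSobolev.embedsContinuously hs0 hs1 hm hA.continuous hq hq',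
    fun _ hq hq' => MagneticSobolev.embedsCompactlyLoc hs0 hs1 hm hA.continuous hq hq'⟩
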